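/- Let $\mathcal A,\mathcal B$ be finite alphabets with the discrete topology, and let $T$ denote the shift $(T\mathbf x)_k=x_{k+1}$ on $\mathcal A^{\mathbb Z}$ and on $\mathcal B^{\mathbb Z}$. A subshift is a non-empty closed $T$-invariant subset ($T(X)=X$). For a subshift $X$, let $\mathcal M(X)$ be the set of finite $T$-invariant Borel measures on the ambient full shift whose support is contained in $X$. For a word $w$, let $[w]$ be the cylinder of all $\mathbf x$ with $x_1\cdots x_{|w|}=w$. Let $\sigma:\mathcal A^*\to\mathcal B^*$ be a non-erasing morphism of free monoids, that is, $|\sigma(a)|\ge 1$ for every $a\in\mathcal A$. It induces * the map $\sigma^{\mathbb Z}:\mathcal A^{\mathbb Z}\to\mathcal B^{\mathbb Z}$ that concatenates the words $\sigma(x_n)$, $n\in\mathbb Z$, with $\sigma(x_1)$ beginning at position $1$; * the map $\sigma^T:\mathcal O(\mathbf x)\mapsto\mathcal O(\sigma^{\mathbb Z}(\mathbf x))$ on shift-orbits $\mathcal O(\mathbf x)=\{T^n\mathbf x : n\in\mathbb Z\}$; * for every subshift $X\subseteq\mathcal A^{\mathbb Z}$, the image subshift $\sigma(X)\subseteq\mathcal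 B^{\mathbb Z}$, which is the intersection of all subshifts that contain $\sigma^{\mathbb Z}(X)$; * the measure transfer, defined as follows. Let $\mathcal A_\sigma$ be the alphabet of letters $a(k)$, $a\in\mathcal A$, $1\le k\le|\sigma(a)|$; let $\pi_\sigma:\mathcal A^*\to\mathcal A_\sigma^*$ be the morphism $a\mapsto a(1)\cdots a(|\sigma(a)|)$, and let $\alpha_\sigma:\mathcal A_\sigma^*\to\mathcal B^*$ be the letter-to-letter morphism sending $a(k)$ to the $k$-th letter of $\sigma(a)$, so that $\sigma=\alpha_\sigma\circ\pi_\sigma$. For $\mu\in\mathcal M(\mathcal A^{\mathbb Z})$ let $\mu_\sigma$ be the unique finite $T$-invariant Borel measure on $\mathcal A_\sigma^{\mathbb Z}$ such that, for every non-empty word $w\in\mathcal A_\sigma^*$, $\mu_\sigma([w])=\mu([\widehat w])$, where $\widehat w\in\mathcal A^*$ is the shortest word such that $w$ is a factor of $\pi_\sigma(\widehat w)$, and $\mu_\sigma([w])=0$ if there is no such word. The transferred measure of $\mu$ is the push-forward of $\mu_\sigma$ under the letterwise map $\mathcal A_\sigma^{\mathbb Z}\to\mathcal B^{\mathbb Z}$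 given by $\alpha_\sigma$. If $\mu\in\mathcal M(X)$, its transferred measure lies in $\mathcal M(\sigma(X))$, which gives the measure transfer map $\sigma_X^{\mathcal M}:\mathcal M(X)\to\mathcal M(\sigma(X))$. **Theorem.** Let $\sigma:\mathcal A^*\to\mathcal B^*$ be a non-erasing morphism of free monoids on finite alphabets and let $X\subseteq\mathcal A^{\mathbb Z}$ be a subshift. If $\sigma$ is shift-orbit injective in $X$, that is, the restriction of $\sigma^T$ to the set of shift-orbits of elements of $X$ is injective, then the measure transfer map $\sigma_X^{\mathcal M}:\mathcal M(X)\to\mathcal M(\sigma(X))$ is injective. -/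

import Mathlib

namespace MeasureTransfer

open MeasureTheory SymbolicDynamics.FullShift
open scoped ENNReal

set_option linter.unusedSectionVars false

/-! ### Morphisms of free monoids and their action on biinfinite words

The free monoid `A*` is `FreeMonoid A`, biinfinite words are functions `ℤ → A`, and the shift
operator `T` is Mathlib's `shift (1 : ℤ)`, so that `T^n` is `shift n`. -/

section Words

variable {A B : Type*}

/-- No letter is mapped to the empty word. -/
def NonErasing (σ : FreeMonoid A →* FreeMonoid B) : Prop :=
  ∀ a, 1 ≤ (σ (FreeMonoid.of a)).length

/-- The image of a letter, as a list of letters. -/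
def img (σ : FreeMonoid A →* FreeMonoid B) (a : A) : List B :=
  (σ (FreeMonoid.of a)).toList

/-- The position in the image of `x` at which the block `σ (x n)` begins. It is normalized by
`blockStart σ x 1 = 1`, and consecutive block positions differ by the block length
(see `blockStart_succ`). -/
noncomputable def blockStart (σ : FreeMonoid A →* FreeMonoid B) (x : ℤ → A) (n : ℤ) : ℤ :=
  1 + ∑ i ∈ Finset.Ico 1 n, ((img σ (x i)).length : ℤ)
    - ∑ i ∈ Finset.Ico n 1, ((img σ (x i)).length : ℤ)

theorem blockStart_one (σ : FreeMonoid A →* FreeMonoid B) (x : ℤ → A) :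
    blockStart σ x 1 = 1 := by simp [blockStart]

theorem blockStart_succ (σ : FreeMonoid A →* FreeMonoid B) (x : ℤ → A) (n : ℤ) :
    blockStart σ x (n + 1) = blockStart σ x n + (img σ (x n)).length := by
  unfold blockStart
  rcases lt_or_ge n 1 with h | h
  · have h1 : Finset.Ico 1 (n + 1) = ∅ := Finset.Ico_eq_empty (by lia)
    have h2 : Finset.Ico 1 n = ∅ := Finset.Ico_eq_empty (by lia)
    have h3 : Finset.Ico n 1 = insert n (Finset.Ico (n + 1) 1) := by
      ext i; simp only [Finset.mem_insert, Finset.mem_Ico]; lia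
    rw [h1, h2, h3, Finset.sum_insert (by simp)]
    ring
  · have h1 : Finset.Ico (n + 1) 1 = ∅ := Finset.Ico_eq_empty (by lia)
    have h2 : Finset.Ico n 1 = ∅ := Finset.Ico_eq_empty (by lia)
    have h3 : Finset.Ico 1 (n + 1) = insert n (Finset.Ico 1 n) := by
      ext i; simp only [Finset.mem_insert, Finset.mem_Ico]; lia
    rw [h1, h2, h3, Finset.sum_insert (by simp)]
    ring

theorem NonErasing.one_le {σ : FreeMonoid A →* FreeMonoid B} (hσ : NonErasing σ) (a : A) :
    1 ≤ (img σ a).length := hσ a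

theorem sub_le_blockStart_sub {σ : FreeMonoid A →* FreeMonoid B} (hσ : NonErasing σ) (x : ℤ → A)
    {m n : ℤ} (h : m ≤ n) : n - m ≤ blockStart σ x n - blockStart σ x m := by
  induction n, h using Int.leInduction with
  | base => simp
  | succ n _ ih =>
    have := blockStart_succ σ x n
    have := hσ.one_le (x n)
    lia

theorem exists_block {σ : FreeMonoid A →* FreeMonoid B} (hσ : NonErasing σ) (x : ℤ → A) (j : ℤ) :
    ∃ n, blockStart σ x n ≤ j ∧ j < blockStart σ x n + (img σ (x n)).length := by
  have hne : ∃ n, blockStart σ x n ≤ j := by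
    rcases le_total j 1 with h | h
    · have := sub_le_blockStart_sub hσ x h
      rw [blockStart_one] at this
      exact ⟨j, by lia⟩
    · exact ⟨1, by rw [blockStart_one]; exact h⟩
  have hbd : ∃ b, ∀ n, blockStart σ x n ≤ j → n ≤ b := by
    refine ⟨max j 1, fun n hn => ?_⟩
    rcases le_total n 1 with h | h
    · exact le_max_of_le_right h
    · have := sub_le_blockStart_sub hσ x h
      rw [blockStart_one] at this
      exact le_max_of_le_left (by lia)
  obtain ⟨n, hn, hmax⟩ := Int.exists_greatest_of_bdd hbd hne
  refine ⟨n, hn, ?_⟩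
  by_contra hc
  have := hmax (n + 1) (by rw [blockStart_succ]; lia)
  lia

theorem block_unique {σ : FreeMonoid A →* FreeMonoid B} (hσ : NonErasing σ) (x : ℤ → A) {j m n : ℤ}
    (hm : blockStart σ x m ≤ j) (hm' : j < blockStart σ x m + (img σ (x m)).length)
    (hn : blockStart σ x n ≤ j) (hn' : j < blockStart σ x n + (img σ (x n)).length) : m = n := by
  have h1 := blockStart_succ σ x m
  have h2 := blockStart_succ σ x n
  rcases lt_trichotomy m n with h | h | h
  · have := sub_le_blockStart_sub hσ x (show m + 1 ≤ n from h)
    lia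
  · exact h
  · have := sub_le_blockStart_sub hσ x (show n + 1 ≤ m from h)
    lia

/-- The index `n` of the block `σ (x n)` that covers the position `j` of the image of `x`. -/
noncomputable def blockIndex (σ : FreeMonoid A →* FreeMonoid B) (hσ : NonErasing σ)
    (x : ℤ → A) (j : ℤ) : ℤ :=
  (exists_block hσ x j).choose

theorem blockStart_blockIndex_le {σ : FreeMonoid A →* FreeMonoid B} (hσ : NonErasing σ)
    (x : ℤ → A) (j : ℤ) : blockStart σ x (blockIndex σ hσ x j) ≤ j :=
  (exists_block hσ x j).choose_spec.1

theorem lt_blockStart_blockIndex {σ : FreeMonoid A →* FreeMonoid B} (hσ : NonErasing σ)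
    (x : ℤ → A) (j : ℤ) :
    j < blockStart σ x (blockIndex σ hσ x j) + (img σ (x (blockIndex σ hσ x j))).length :=
  (exists_block hσ x j).choose_spec.2

/-- The induced map on biinfinite words: it concatenates the words `σ (x n)`, the block `σ (x 1)`
beginning at position `1`. -/
noncomputable def wordMap (σ : FreeMonoid A →* FreeMonoid B) (hσ : NonErasing σ)
    (x : ℤ → A) : ℤ → B := fun j =>
  (img σ (x (blockIndex σ hσ x j)))[(j - blockStart σ x (blockIndex σ hσ x j)).toNat]'(by
    have h1 := blockStart_blockIndex_le hσ x j
    have h2 := lt_blockStart_blockIndex hσ x j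
    lia)

theorem wordMap_of_block {σ : FreeMonoid A →* FreeMonoid B} (hσ : NonErasing σ) (x : ℤ → A)
    (n : ℤ) (k : ℕ) (hk : k < (img σ (x n)).length) (j : ℤ) (hj : j = blockStart σ x n + k) :
    wordMap σ hσ x j = (img σ (x n))[k] := by
  have h : blockIndex σ hσ x j = n :=
    block_unique hσ x (blockStart_blockIndex_le hσ x _) (lt_blockStart_blockIndex hσ x _)
      (by lia) (by lia)
  unfold wordMap
  simp only [h]
  congr 1
  lia

theorem blockStart_shift (σ : FreeMonoid A →* FreeMonoid B) (x : ℤ → A) (m n : ℤ) :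
    blockStart σ (shift m x) n = blockStart σ x (m + n) - blockStart σ x (m + 1) + 1 := by
  induction n using Int.inductionOn' (b := 1) with
  | zero => simp [blockStart_one]
  | succ k _ ih =>
    have h := blockStart_succ σ x (m + k)
    rw [blockStart_succ, ih, ← add_assoc, h, shift_apply]
    ring
  | pred k _ ih =>
    have h := blockStart_succ σ x (m + (k - 1))
    have h' := blockStart_succ σ (shift m x) (k - 1)
    rw [shift_apply] at h'
    rw [show m + (k - 1) + 1 = m + k by ring] at h
    rw [sub_add_cancel] at h'
    lia

theorem wordMap_shift {σ : FreeMonoid A →* FreeMonoid B} (hσ : NonErasing σ) (m : ℤ) (x : ℤ → A) :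
    wordMap σ hσ (shift m x) = shift (blockStart σ x (m + 1) - 1) (wordMap σ hσ x) := by
  funext j
  obtain ⟨n, h1, h2⟩ := exists_block hσ (shift m x) j
  rw [wordMap_of_block hσ (shift m x) n (j - blockStart σ (shift m x) n).toNat (by lia) j (by lia)]
  have hlt : (j - blockStart σ (shift m x) n).toNat < (img σ (x (m + n))).length := by
    have : img σ (shift m x n) = img σ (x (m + n)) := rfl
    rw [← this]
    lia
  have e : shift (blockStart σ x (m + 1) - 1) (wordMap σ hσ x) j
      = wordMap σ hσ x (blockStart σ x (m + 1) - 1 + j) := rfl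
  rw [e, wordMap_of_block hσ x (m + n) (j - blockStart σ (shift m x) n).toNat hlt]
  · rfl
  · have := blockStart_shift σ x m n
    lia

/-- Two biinfinite words are equivalent if one is a shift-translate of the other. -/
def orbitSetoid (A : Type*) : Setoid (ℤ → A) where
  r x y := ∃ n : ℤ, shift n x = y
  iseqv :=
    { refl := fun x => ⟨0, by simp⟩
      symm := by
        rintro x _ ⟨n, rfl⟩
        exact ⟨-n, by rw [← shift_add]; simp⟩
      trans := by
        rintro x _ _ ⟨n, rfl⟩ ⟨m, rfl⟩
        exact ⟨n + m, shift_add n m x⟩ }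

/-- The set of shift-orbits of biinfinite words. -/
def ShiftOrbits (A : Type*) : Type _ := Quotient (orbitSetoid A)

/-- The shift-orbit of a biinfinite word. -/
def shiftOrbit (x : ℤ → A) : ShiftOrbits A := Quotient.mk (orbitSetoid A) x

/-- The map induced on shift-orbits, sending the orbit of `x` to that of its image. -/
noncomputable def orbitMap (σ : FreeMonoid A →* FreeMonoid B) (hσ : NonErasing σ) :
    ShiftOrbits A → ShiftOrbits B :=
  Quotient.map (wordMap σ hσ) (by
    rintro x _ ⟨n, rfl⟩
    exact ⟨_, (wordMap_shift hσ n x).symm⟩)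

/-- The map induced on shift-orbits is injective on the set of shift-orbits of `X`. -/
def ShiftOrbitInjective (σ : FreeMonoid A →* FreeMonoid B) (hσ : NonErasing σ)
    (X : Set (ℤ → A)) : Prop :=
  Set.InjOn (orbitMap σ hσ) (shiftOrbit '' X)

/-- The cylinder of a word `w`: all `x` with `x 1 x 2 ⋯ x |w| = w`. -/
def cylinder (w : FreeMonoid A) : Set (ℤ → A) :=
  {x | ∀ (i : ℕ) (h : i < w.toList.length), x (1 + i) = w.toList[i]}

end Words

/-! ### Subdivision and letter-to-letter morphisms -/

section Subdivision

variable {A B : Type*}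

/-- The subdivision alphabet: the letters `a(k)`, `k = 0, …, ℓ a - 1`. -/
abbrev SubdivAlphabet (ℓ : A → ℕ) : Type _ := Σ a : A, Fin (ℓ a)

/-- The subdivision morphism `a ↦ a(0) a(1) ⋯ a(ℓ a - 1)`. -/
def subdivision (ℓ : A → ℕ) : FreeMonoid A →* FreeMonoid (SubdivAlphabet ℓ) :=
  FreeMonoid.lift fun a => FreeMonoid.ofList (List.ofFn fun k : Fin (ℓ a) => ⟨a, k⟩)

theorem img_subdivision (ℓ : A → ℕ) (a : A) :
    img (subdivision ℓ) a = List.ofFn fun k : Fin (ℓ a) => (⟨a, k⟩ : SubdivAlphabet ℓ) := by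
  simp [img, subdivision]

theorem nonErasing_subdivision {ℓ : A → ℕ} (hℓ : ∀ a, 1 ≤ ℓ a) : NonErasing (subdivision ℓ) := by
  intro a
  have : (img (subdivision ℓ) a).length = ℓ a := by simp [img_subdivision]
  exact (hℓ a).trans_eq this.symm

/-- `v` is a shortest word over `A` whose subdivision contains `w` as a factor. -/
def IsShortestCover (ℓ : A → ℕ) (w : FreeMonoid (SubdivAlphabet ℓ)) (v : FreeMonoid A) : Prop :=
  w.toList <:+: (subdivision ℓ v).toList ∧
    ∀ v' : FreeMonoid A, w.toList <:+: (subdivision ℓ v').toList → v.length ≤ v'.length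

/-- The length function of `σ`. -/
def lengthFun (σ : FreeMonoid A →* FreeMonoid B) (a : A) : ℕ := (σ (FreeMonoid.of a)).length

theorem NonErasing.one_le_lengthFun {σ : FreeMonoid A →* FreeMonoid B} (hσ : NonErasing σ) (a : A) :
    1 ≤ lengthFun σ a := hσ a

/-- The letter-to-letter morphism `a(k) ↦ σ(a)_k`, given by its map of alphabets. -/
def letterMap (σ : FreeMonoid A →* FreeMonoid B) : SubdivAlphabet (lengthFun σ) → B :=
  fun p => (σ (FreeMonoid.of p.1)).toList[p.2.1]'p.2.2

/-- The canonical decomposition of `σ` into a subdivision morphism followed by a letter-to-letter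
morphism. -/
theorem canonical_decomposition (σ : FreeMonoid A →* FreeMonoid B) :
    (FreeMonoid.map (letterMap σ)).comp (subdivision (lengthFun σ)) = σ := by
  refine FreeMonoid.hom_eq fun a => ?_
  apply FreeMonoid.toList.injective
  have h : (subdivision (lengthFun σ) (FreeMonoid.of a)).toList = _ :=
    img_subdivision (lengthFun σ) a
  rw [MonoidHom.comp_apply, FreeMonoid.toList_map, h]
  apply List.ext_getElem
  · rw [List.length_map, List.length_ofFn]
    rfl
  · intro i h1 h2
    simp [letterMap]
    rfl

end Subdivision

/-! ### Invariant measures on subshifts -/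

section Measures

instance {ι : Type*} {α : ι → Type*} [∀ i, MeasurableSpace (α i)]
    [∀ i, DiscreteMeasurableSpace (α i)] : DiscreteMeasurableSpace (Σ i, α i) where
  forall_measurableSet s := by
    refine MeasurableSpace.measurableSet_iInf.2 fun i => ?_
    exact MeasurableSet.of_discrete (α := α i)

variable {A B : Type*} [Finite A] [TopologicalSpace A] [DiscreteTopology A] [MeasurableSpace A]
  [DiscreteMeasurableSpace A] [Finite B] [TopologicalSpace B] [DiscreteTopology B]
  [MeasurableSpace B] [DiscreteMeasurableSpace B]

/-- The invariant measures on a subshift `X`: the finite Borel measures on the ambient full shift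
which are invariant under the shift operator and whose support is contained in `X`. -/
def InvariantMeasure {A : Type*} [TopologicalSpace A] [MeasurableSpace A] (X : Subshift A ℤ) :
    Type _ :=
  {μ : Measure (ℤ → A) // IsFiniteMeasure μ ∧ MeasurePreserving (shift (1 : ℤ)) μ μ ∧
    μ.support ⊆ X.carrier}

/-- An invariant measure on a subshift, viewed as an invariant measure on the full shift. -/
def InvariantMeasure.toFull {A : Type*} [TopologicalSpace A] [MeasurableSpace A]
    {X : Subshift A ℤ} (μ : InvariantMeasure X) : InvariantMeasure (fullShift A ℤ) :=
  ⟨μ.1, μ.2.1, μ.2.2.1, Set.subset_univ _⟩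

theorem measure_compl_eq_zero_iff (μ : Measure (ℤ → A)) (X : Subshift A ℤ) :
    μ X.carrierᶜ = 0 ↔ μ.support ⊆ X.carrier := by
  constructor
  · intro h
    exact Measure.support_subset_of_isClosed X.isClosed (by rwa [mem_ae_iff])
  · intro h
    exact measure_mono_null (Set.compl_subset_compl.2 h) Measure.measure_compl_support

theorem measurable_shift {A : Type*} [MeasurableSpace A] (n : ℤ) :
    Measurable (shift n : (ℤ → A) → (ℤ → A)) :=
  measurable_pi_lambda _ fun j => measurable_pi_apply (n + j)

theorem measurePreserving_shift {A : Type*} [MeasurableSpace A] {μ : Measure (ℤ → A)}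
    (h : MeasurePreserving (shift (1 : ℤ)) μ μ) (n : ℤ) :
    MeasurePreserving (shift n) μ μ := by
  have hneg : MeasurePreserving (shift (-1 : ℤ)) μ μ := by
    refine ⟨measurable_shift _, ?_⟩
    conv_lhs => rw [← h.map_eq]
    rw [Measure.map_map (measurable_shift _) (measurable_shift _)]
    have : (shift (-1 : ℤ) ∘ shift (1 : ℤ) : (ℤ → A) → (ℤ → A)) = id := by
      funext x
      simp [← shift_add]
    rw [this, Measure.map_id]
  induction n using Int.induction_on with
  | zero =>
    have : (shift (0 : ℤ) : (ℤ → A) → (ℤ → A)) = id := by funext x; simp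
    rw [this]; exact MeasurePreserving.id μ
  | succ k ih =>
    have : (shift ((k : ℤ) + 1) : (ℤ → A) → (ℤ → A)) = shift (1 : ℤ) ∘ shift (k : ℤ) := by
      funext x; simp [← shift_add]
    rw [this]; exact h.comp ih
  | pred k ih =>
    have : (shift (-(k : ℤ) - 1) : (ℤ → A) → (ℤ → A)) = shift (-1 : ℤ) ∘ shift (-(k : ℤ)) := by
      funext x; simp [← shift_add, sub_eq_add_neg]
    rw [this]; exact hneg.comp ih

theorem measurableSet_cylinder {A : Type*} [MeasurableSpace A] [DiscreteMeasurableSpace A]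
    (w : FreeMonoid A) : MeasurableSet (cylinder w) := by
  have : cylinder w = ⋂ (i : ℕ) (h : i < w.toList.length),
      (fun x : ℤ → A => x (1 + i)) ⁻¹' {w.toList[i]} := by
    ext x; simp [cylinder]
  rw [this]
  exact MeasurableSet.iInter fun i => MeasurableSet.iInter fun _ =>
    measurable_pi_apply _ (MeasurableSet.singleton _)

/-- An invariant measure is determined by its values on the cylinders of non-empty words. -/
theorem ext_of_cylinder {A : Type*} [Finite A] [MeasurableSpace A] [DiscreteMeasurableSpace A]
    {μ ν : Measure (ℤ → A)} [IsFiniteMeasure μ] [IsFiniteMeasure ν]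
    (hμ : MeasurePreserving (shift (1 : ℤ)) μ μ) (hν : MeasurePreserving (shift (1 : ℤ)) ν ν)
    (h : ∀ w : FreeMonoid A, w ≠ 1 → μ (cylinder w) = ν (cylinder w)) : μ = ν := by
  have key : ∀ (N : ℕ), μ.map (Finset.Icc (-(N : ℤ)) N).restrict
      = ν.map (Finset.Icc (-(N : ℤ)) N).restrict := by
    intro N
    refine Measure.ext_of_singleton fun z => ?_
    rw [Measure.map_apply (by fun_prop) (MeasurableSet.singleton z),
      Measure.map_apply (by fun_prop) (MeasurableSet.singleton z)]
    let w : FreeMonoid A := FreeMonoid.ofList (List.ofFn fun t : Fin (2 * N + 1) =>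
      z ⟨-N + (t : ℤ), by have := t.2; simp only [Finset.mem_Icc]; lia⟩)
    have hw : w ≠ 1 := by
      intro e
      have := congrArg (fun v => v.toList.length) e
      simp [w] at this
    have hset : (Finset.restrict (π := fun _ : ℤ => A) (Finset.Icc (-(N : ℤ)) N)) ⁻¹' {z}
        = shift (-(N : ℤ) - 1) ⁻¹' cylinder w := by
      ext x
      simp only [Set.mem_preimage, Set.mem_singleton_iff, cylinder, Set.mem_ofPred_eq]
      constructor
      · rintro rfl i hi
        simp only [w, FreeMonoid.toList_ofList, List.getElem_ofFn, shift_apply,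
          Finset.restrict]
        congr 1
        ring
      · intro hx
        funext i
        obtain ⟨i, hi⟩ := i
        have hi' := Finset.mem_Icc.1 hi
        have := hx (i + N).toNat (by simp only [w, FreeMonoid.toList_ofList, List.length_ofFn]; lia)
        simp only [w, FreeMonoid.toList_ofList, List.getElem_ofFn, shift_apply] at this
        simp only [Finset.restrict]
        have e1 : -(N : ℤ) - 1 + (1 + ((i + N).toNat : ℤ)) = i := by lia
        have e2 : -(N : ℤ) + ((i + N).toNat : ℤ) = i := by lia
        simp only [e1, e2] at this
        exact this
    have hm := measurableSet_cylinder w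
    rw [hset, (measurePreserving_shift hμ _).measure_preimage hm.nullMeasurableSet,
      (measurePreserving_shift hν _).measure_preimage hm.nullMeasurableSet, h w hw]
  have proj : ∀ I : Finset ℤ, μ.map I.restrict = ν.map I.restrict := by
    intro I
    obtain ⟨N, hN⟩ : ∃ N : ℕ, I ⊆ Finset.Icc (-(N : ℤ)) N := by
      refine ⟨I.sup Int.natAbs, fun i hi => ?_⟩
      have := Finset.le_sup (f := Int.natAbs) hi
      simp only [Finset.mem_Icc]
      lia
    have hc : (I.restrict : (ℤ → A) → _) = Finset.restrict₂ hN ∘ Finset.restrict _ := rfl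
    rw [hc, ← Measure.map_map (by fun_prop) (by fun_prop), key N,
      Measure.map_map (by fun_prop) (by fun_prop)]
  have : ∀ I : Finset ℤ, IsFiniteMeasure (μ.map I.restrict) := fun I => inferInstance
  exact IsProjectiveLimit.unique (P := fun I => μ.map I.restrict) (fun I => rfl)
    (fun I => (proj I).symm)

end Measures

/-! ### Existence of the subdivision measure -/

section Prefix

variable {A B : Type*}

/-- The word `x 1 x 2 ⋯ x N`. -/
def prefixWord (x : ℤ → A) (N : ℕ) : FreeMonoid A :=
  FreeMonoid.ofList (List.ofFn fun i : Fin N => x (1 + (i : ℕ)))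

theorem length_prefixWord (x : ℤ → A) (N : ℕ) : (prefixWord x N).length = N := by
  simp [prefixWord, FreeMonoid.length]

theorem prefixWord_succ (x : ℤ → A) (N : ℕ) :
    prefixWord x (N + 1) = prefixWord x N * FreeMonoid.of (x (1 + N)) := by
  apply FreeMonoid.toList.injective
  simp only [prefixWord, FreeMonoid.toList_ofList, FreeMonoid.toList_mul, FreeMonoid.toList_of]
  rw [List.ofFn_succ_last]
  simp

theorem mem_cylinder_iff (x : ℤ → A) (w : FreeMonoid A) :
    x ∈ cylinder w ↔ prefixWord x w.length = w := by
  rw [← FreeMonoid.toList.injective.eq_iff]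
  simp only [cylinder, Set.mem_ofPred_eq, prefixWord, FreeMonoid.toList_ofList]
  constructor
  · intro h
    apply List.ext_getElem
    · simp [FreeMonoid.length]
    · intro i h1 h2
      simpa using h i h2
  · intro h i hi
    have h' := congrArg (fun l => l[i]?) h
    have hi' : i < w.length := hi
    simpa [hi, hi', List.getElem?_ofFn] using h'

theorem toList_image_mul (σ : FreeMonoid A →* FreeMonoid B) (u v : FreeMonoid A) :
    (σ (u * v)).toList = (σ u).toList ++ (σ v).toList := by
  rw [map_mul, FreeMonoid.toList_mul]

/-- The word `σ (x 1 ⋯ x N)` is read off the image of `x` from position `1` on. -/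
theorem image_prefix {σ : FreeMonoid A →* FreeMonoid B} (hσ : NonErasing σ) (x : ℤ → A) (N : ℕ) :
    ((σ (prefixWord x N)).toList.length : ℤ) = blockStart σ x (1 + N) - 1 ∧
      ∀ (i : ℕ) (h : i < (σ (prefixWord x N)).toList.length),
        wordMap σ hσ x (1 + i) = (σ (prefixWord x N)).toList[i] := by
  induction N with
  | zero =>
    have : prefixWord x 0 = 1 := by apply FreeMonoid.toList.injective; simp [prefixWord]
    simp [this, blockStart_one]
  | succ N ih =>
    have e : (σ (prefixWord x (N + 1))).toList
        = (σ (prefixWord x N)).toList ++ img σ (x (1 + N)) := by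
      rw [prefixWord_succ, map_mul, FreeMonoid.toList_mul]; rfl
    have hs := blockStart_succ σ x (1 + N)
    obtain ⟨ih1, ih2⟩ := ih
    refine ⟨?_, fun i hi => ?_⟩
    · rw [e, List.length_append]
      push_cast
      rw [← add_assoc, hs]
      lia
    · simp only [e]
      rw [List.getElem_append]
      split_ifs with h
      · exact ih2 i h
      · rw [e, List.length_append] at hi
        exact wordMap_of_block hσ x (1 + N) _ (by lia) _ (by lia)

theorem mem_cylinder_of_image_prefix {σ : FreeMonoid A →* FreeMonoid B} (hσ : NonErasing σ)
    (x : ℤ → A) (N : ℕ) (p s : List B) (w : FreeMonoid B)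
    (h : p ++ w.toList ++ s = (σ (prefixWord x N)).toList) :
    shift (p.length : ℤ) (wordMap σ hσ x) ∈ cylinder w := by
  intro i hi
  have h1 := (image_prefix hσ x N).2 (p.length + i)
    (by rw [← h]; simp only [List.length_append]; lia)
  have e : shift (p.length : ℤ) (wordMap σ hσ x) (1 + i)
      = wordMap σ hσ x (1 + ((p.length + i : ℕ) : ℤ)) := by
    rw [shift_apply]; congr 1; push_cast; ring
  rw [e, h1]
  simp only [← h]
  rw [List.getElem_append_left (by simp only [List.length_append]; lia),
    List.getElem_append_right (by lia)]
  simp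

end Prefix

section Cover

variable {A : Type*} {ℓ : A → ℕ}

theorem length_img_subdivision (a : A) : (img (subdivision ℓ) a).length = ℓ a := by
  simp [img_subdivision]

theorem getElem_img_subdivision (a : A) (k : ℕ) (h : k < (img (subdivision ℓ) a).length) :
    (img (subdivision ℓ) a)[k] = ⟨a, ⟨k, by rwa [length_img_subdivision] at h⟩⟩ := by
  simp only [img_subdivision]
  exact List.getElem_ofFn _

theorem wordMap_subdivision (hℓ : ∀ a, 1 ≤ ℓ a) (x : ℤ → A) (k : ℕ) (hk : k < ℓ (x 1)) :
    wordMap (subdivision ℓ) (nonErasing_subdivision hℓ) x (1 + k) = ⟨x 1, ⟨k, hk⟩⟩ := by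
  rw [wordMap_of_block (nonErasing_subdivision hℓ) x 1 k (by rwa [length_img_subdivision]) _
    (by rw [blockStart_one]), getElem_img_subdivision]

/-- In a shortest cover `v` of `w`, the excess of the subdivision of `v` over `w` on the left is
shorter than the first block, and that on the right is shorter than the last block. -/
theorem IsShortestCover.left_lt {w : FreeMonoid (SubdivAlphabet ℓ)} {c : A} {v : FreeMonoid A}
    (h : IsShortestCover ℓ w (FreeMonoid.of c * v)) {p s : List (SubdivAlphabet ℓ)}
    (e : p ++ w.toList ++ s = (subdivision ℓ (FreeMonoid.of c * v)).toList) : p.length < ℓ c := by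
  by_contra hc
  rw [map_mul, FreeMonoid.toList_mul] at e
  change _ = img (subdivision ℓ) c ++ _ at e
  have hl := length_img_subdivision (ℓ := ℓ) c
  have hpre : img (subdivision ℓ) c <+: p := by
    refine List.prefix_of_prefix_length_le (l₃ := p ++ w.toList ++ s) ?_ ?_ (by lia)
    · rw [e]; exact List.prefix_append _ _
    · rw [List.append_assoc]; exact List.prefix_append _ _
  obtain ⟨q, rfl⟩ := hpre
  have h2 : q ++ w.toList ++ s = (subdivision ℓ v).toList := by
    simpa [List.append_assoc] using e
  have := h.2 v ⟨q, s, h2⟩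
  rw [FreeMonoid.length_mul, FreeMonoid.length_of] at this
  lia

theorem IsShortestCover.right_lt {w : FreeMonoid (SubdivAlphabet ℓ)} {c : A} {v : FreeMonoid A}
    (h : IsShortestCover ℓ w (v * FreeMonoid.of c)) {p s : List (SubdivAlphabet ℓ)}
    (e : p ++ w.toList ++ s = (subdivision ℓ (v * FreeMonoid.of c)).toList) : s.length < ℓ c := by
  by_contra hc
  rw [map_mul, FreeMonoid.toList_mul] at e
  change _ = _ ++ img (subdivision ℓ) c at e
  have hl := length_img_subdivision (ℓ := ℓ) c
  have hpre : img (subdivision ℓ) c <:+ s := by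
    refine List.suffix_of_suffix_length_le (l₃ := p ++ w.toList ++ s) ?_ ?_ (by lia)
    · rw [e]; exact List.suffix_append _ _
    · exact List.suffix_append _ _
  obtain ⟨q, rfl⟩ := hpre
  have h2 : p ++ w.toList ++ q = (subdivision ℓ v).toList := by
    rw [← List.append_assoc] at e
    exact List.append_cancel_right e
  have := h.2 v ⟨p, q, h2⟩
  rw [FreeMonoid.length_mul, FreeMonoid.length_of] at this
  lia

theorem exists_isShortestCover {w : FreeMonoid (SubdivAlphabet ℓ)}
    (h : ∃ v : FreeMonoid A, w.toList <:+: (subdivision ℓ v).toList) :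
    ∃ v, IsShortestCover ℓ w v := by
  classical
  have h' : ∃ n, ∃ v : FreeMonoid A, v.length = n ∧ w.toList <:+: (subdivision ℓ v).toList :=
    let ⟨v, hv⟩ := h; ⟨_, v, rfl, hv⟩
  obtain ⟨v, hv, hw⟩ := Nat.find_spec h'
  exact ⟨v, hw, fun v' hv' => hv.trans_le (Nat.find_min' h' ⟨v', rfl, hv'⟩)⟩

theorem cylinder_tower_of_cover (hℓ : ∀ a, 1 ≤ ℓ a) {w : FreeMonoid (SubdivAlphabet ℓ)}
    (hw : w.toList ≠ []) {v : FreeMonoid A} (hv : IsShortestCover ℓ w v) :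
    {x : ℤ → A | x 1 = (w.toList.head hw).1 ∧ shift ((w.toList.head hw).2 : ℤ)
      (wordMap (subdivision ℓ) (nonErasing_subdivision hℓ) x) ∈ cylinder w} = cylinder v := by
  have hne := nonErasing_subdivision hℓ
  obtain ⟨p, s, e⟩ := hv.1
  have hw0 : 0 < w.toList.length := List.length_pos_iff.2 hw
  -- the first letter of the cover
  obtain ⟨c, v', rfl⟩ : ∃ c v', v = FreeMonoid.of c * v' := by
    induction v using FreeMonoid.casesOn with
    | one => simp [hw] at e
    | of_mul c v' => exact ⟨c, v', rfl⟩
  have hp := hv.left_lt e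
  have hhead : w.toList.head hw = ⟨c, ⟨p.length, hp⟩⟩ := by
    have h1 : (subdivision ℓ (FreeMonoid.of c * v')).toList
        = img (subdivision ℓ) c ++ (subdivision ℓ v').toList := by
      rw [map_mul, FreeMonoid.toList_mul]; rfl
    have h2 : p.length < (img (subdivision ℓ) c).length := by rwa [length_img_subdivision]
    have h3 := congrArg (fun l => l[p.length]?) (e.trans h1)
    rw [List.getElem?_append_left h2, List.getElem?_append_left (by
      simp only [List.length_append]; lia), List.getElem?_append_right le_rfl, Nat.sub_self,
      List.getElem?_eq_getElem h2, List.getElem?_eq_getElem hw0, getElem_img_subdivision] at h3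
    rw [List.head_eq_getElem]
    exact Option.some_injective _ h3
  have hhead1 : (w.toList.head hw).1 = c := by rw [hhead]
  have hhead2 : ((w.toList.head hw).2 : ℕ) = p.length := by rw [hhead]
  set v := FreeMonoid.of c * v' with hvdef
  have hvlen : v.length = v'.length + 1 := by simp [hvdef, add_comm]
  ext x
  rw [Set.mem_ofPred_eq, hhead2, hhead1]
  constructor
  · rintro ⟨hx1, hx⟩
    have key : ∀ m ≤ v.length, (prefixWord x m).toList = v.toList.take m := by
      intro m
      induction m with
      | zero => intro _; simp [prefixWord]
      | succ m ih =>
        intro hm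
        have ih := ih (by lia)
        have hm' : m < v.toList.length := hm
        rw [prefixWord_succ, FreeMonoid.toList_mul, ih, FreeMonoid.toList_of,
          List.take_succ_eq_append_getElem hm']
        congr 2
        rcases Nat.eq_zero_or_pos m with rfl | hm0
        · simp [hvdef, hx1]
        -- split `v` at the letter number `m`
        let d := v.toList[m]
        have hsplit : v = prefixWord x m * (FreeMonoid.of d *
            FreeMonoid.ofList (v.toList.drop (m + 1))) := by
          apply FreeMonoid.toList.injective
          simp only [FreeMonoid.toList_mul, FreeMonoid.toList_of, FreeMonoid.toList_ofList, ih, d]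
          rw [List.singleton_append, List.getElem_cons_drop, List.take_append_drop]
        have himg : (subdivision ℓ v).toList = (subdivision ℓ (prefixWord x m)).toList ++
            (img (subdivision ℓ) d ++
              (subdivision ℓ (FreeMonoid.ofList (v.toList.drop (m + 1)))).toList) := by
          conv_lhs => rw [hsplit]
          rw [toList_image_mul, toList_image_mul]; rfl
        -- the block of that letter begins inside `w`
        have hq1 : p.length < (subdivision ℓ (prefixWord x m)).toList.length := by
          obtain ⟨m', rfl⟩ : ∃ m', m = m' + 1 := ⟨m - 1, by lia⟩
          have h1 : prefixWord x (m' + 1)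
              = FreeMonoid.of c * FreeMonoid.ofList (v'.toList.take m') := by
            apply FreeMonoid.toList.injective
            rw [ih, hvdef]; simp
          rw [h1, map_mul, FreeMonoid.toList_mul, List.length_append]
          have h2 : ((subdivision ℓ) (FreeMonoid.of c)).toList.length = ℓ c :=
            length_img_subdivision c
          lia
        have hq2 : (subdivision ℓ (prefixWord x m)).toList.length < p.length + w.toList.length := by
          obtain ⟨u, b, hub⟩ : ∃ u b, FreeMonoid.of d *
              FreeMonoid.ofList (v.toList.drop (m + 1)) = u * FreeMonoid.of b := by
            refine ⟨FreeMonoid.ofList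
              (d :: v.toList.drop (m + 1)).dropLast, (d :: v.toList.drop (m + 1)).getLast (by simp),
              ?_⟩
            apply FreeMonoid.toList.injective
            simp only [FreeMonoid.toList_mul, FreeMonoid.toList_of, FreeMonoid.toList_ofList]
            rw [List.dropLast_append_getLast]; rfl
          have hv2 : v = prefixWord x m * u * FreeMonoid.of b := by
            rw [mul_assoc, ← hub]; exact hsplit
          have hs : s.length < ℓ b := by
            rw [hv2] at hv e
            exact hv.right_lt e
          have hlen := congrArg List.length e
          have h2 : ((subdivision ℓ) (FreeMonoid.of b)).toList.length = ℓ b :=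
            length_img_subdivision b
          rw [hv2, toList_image_mul, toList_image_mul] at hlen
          simp only [List.length_append, h2] at hlen
          lia
        set q := (subdivision ℓ (prefixWord x m)).toList.length with hq
        have hd0 : 0 < (img (subdivision ℓ) d).length := hne.one_le d
        have hx0 : 0 < (img (subdivision ℓ) (x (1 + m))).length := hne.one_le _
        have hwq : w.toList[q - p.length]'(by lia) = ⟨d, ⟨0, hℓ d⟩⟩ := by
          have h3 := congrArg (fun l => l[q]?) (e.trans himg)
          rw [List.getElem?_append_left (by simp only [List.length_append]; lia),
            List.getElem?_append_right (by lia), List.getElem?_append_right (by lia),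
            Nat.sub_self, List.getElem?_append_left hd0, List.getElem?_eq_getElem hd0,
            List.getElem?_eq_getElem (by lia), getElem_img_subdivision] at h3
          exact Option.some_injective _ h3
        have hxq := hx (q - p.length) (by lia)
        rw [hwq, shift_apply, wordMap_of_block hne x (1 + m) 0 hx0 _ (by
          have := (image_prefix hne x m).1
          push_cast; lia), getElem_img_subdivision] at hxq
        exact congrArg Sigma.fst hxq
    rw [mem_cylinder_iff]
    apply FreeMonoid.toList.injective
    rw [key _ le_rfl]
    exact List.take_length
  · intro hx
    refine ⟨?_, ?_⟩
    · simpa [hvdef] using hx 0 (by simp [hvdef])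
    · rw [mem_cylinder_iff] at hx
      exact mem_cylinder_of_image_prefix hne x v.length p s w (by rw [hx, e])

theorem cylinder_tower_of_not_cover (hℓ : ∀ a, 1 ≤ ℓ a) {w : FreeMonoid (SubdivAlphabet ℓ)}
    (h : ¬ ∃ v, IsShortestCover ℓ w v) (x : ℤ → A) (k : ℕ) :
    shift (k : ℤ) (wordMap (subdivision ℓ) (nonErasing_subdivision hℓ) x) ∉ cylinder w := by
  have hne := nonErasing_subdivision hℓ
  intro hx
  apply h
  apply exists_isShortestCover
  let N := k + w.toList.length
  refine ⟨prefixWord x N, ?_⟩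
  obtain ⟨h1, h2⟩ := image_prefix hne x N
  have h3 := sub_le_blockStart_sub hne x (show (1 : ℤ) ≤ 1 + N by lia)
  rw [blockStart_one] at h3
  have hN : k + w.toList.length ≤ (subdivision ℓ (prefixWord x N)).toList.length := by lia
  have : w.toList = ((subdivision ℓ (prefixWord x N)).toList.drop k).take w.toList.length := by
    apply List.ext_getElem
    · simp only [List.length_take, List.length_drop]; lia
    · intro i hi hi'
      rw [List.getElem_take, List.getElem_drop, ← h2 (k + i) (by lia), ← hx i hi, shift_apply]
      congr 1
      push_cast; ring
  rw [this]
  exact (List.take_prefix _ _).isInfix.trans (List.drop_suffix _ _).isInfix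

end Cover

section Transfer

variable {A B : Type*} [Finite A] [TopologicalSpace A] [DiscreteTopology A] [MeasurableSpace A]
  [DiscreteMeasurableSpace A] [Finite B] [TopologicalSpace B] [DiscreteTopology B]
  [MeasurableSpace B] [DiscreteMeasurableSpace B]

open Classical in
/-- The value `μ [ŵ]`, where `ŵ` is the shortest word whose subdivision contains `w` as a factor,
and `0` if there is no such word. (For `w` non-empty, the value does not depend on the choice of
`ŵ`, see `subdivWeight_eq`.) -/
noncomputable def subdivWeight {A : Type*} [MeasurableSpace A] (ℓ : A → ℕ) (μ : Measure (ℤ → A))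
    (w : FreeMonoid (SubdivAlphabet ℓ)) : ℝ≥0∞ :=
  if h : ∃ v, IsShortestCover ℓ w v then μ (cylinder h.choose) else 0

theorem subdivWeight_eq {A : Type*} [MeasurableSpace A] {ℓ : A → ℕ} (hℓ : ∀ a, 1 ≤ ℓ a)
    (μ : Measure (ℤ → A)) {w : FreeMonoid (SubdivAlphabet ℓ)} (hw : w ≠ 1) {v : FreeMonoid A}
    (hv : IsShortestCover ℓ w v) : subdivWeight ℓ μ w = μ (cylinder v) := by
  have hw' : w.toList ≠ [] := fun h => hw (FreeMonoid.toList.injective h)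
  have h : ∃ v, IsShortestCover ℓ w v := ⟨v, hv⟩
  rw [subdivWeight, dif_pos h, ← cylinder_tower_of_cover hℓ hw' hv,
    ← cylinder_tower_of_cover hℓ hw' h.choose_spec]

theorem measurable_blockStart {A B : Type*} [MeasurableSpace A] [DiscreteMeasurableSpace A]
    (σ : FreeMonoid A →* FreeMonoid B) (n : ℤ) :
    Measurable fun x : ℤ → A => blockStart σ x n := by
  have h : ∀ i : ℤ, Measurable fun x : ℤ → A => ((img σ (x i)).length : ℤ) := fun i =>
    (Measurable.of_discrete (f := fun a : A => ((img σ a).length : ℤ))).comp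
      (measurable_pi_apply i)
  unfold blockStart
  exact (measurable_const.add (Finset.measurable_sum _ fun i _ => h i)).sub
    (Finset.measurable_sum _ fun i _ => h i)

theorem measurable_wordMap {σ : FreeMonoid A →* FreeMonoid B} (hσ : NonErasing σ) :
    Measurable (wordMap σ hσ) := by
  refine measurable_pi_lambda _ fun j => ?_
  intro S _
  have : (fun x : ℤ → A => wordMap σ hσ x j) ⁻¹' S = ⋃ n : ℤ,
      (fun x : ℤ → A => (x n, blockStart σ x n)) ⁻¹'
        {q | ∃ h : q.2 ≤ j ∧ j < q.2 + (img σ q.1).length,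
          (img σ q.1)[(j - q.2).toNat]'(by lia) ∈ S} := by
    ext x
    simp only [Set.mem_preimage, Set.mem_iUnion, Set.mem_ofPred_eq]
    constructor
    · intro h
      exact ⟨blockIndex σ hσ x j, ⟨blockStart_blockIndex_le hσ x j,
        lt_blockStart_blockIndex hσ x j⟩, h⟩
    · rintro ⟨n, h, hS⟩
      rwa [wordMap_of_block hσ x n (j - blockStart σ x n).toNat (by lia) j (by lia)]
  rw [this]
  exact MeasurableSet.iUnion fun n => ((measurable_pi_apply n).prodMk (measurable_blockStart σ n))
    (MeasurableSet.of_discrete)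

/-- An explicit construction of the subdivision measure, as a sum over the letters `a(k)` of the
subdivision alphabet. -/
noncomputable def towerMeasure {A : Type*} [MeasurableSpace A] (ℓ : A → ℕ) (hℓ : ∀ a, 1 ≤ ℓ a)
    (μ : Measure (ℤ → A)) : Measure (ℤ → SubdivAlphabet ℓ) :=
  Measure.sum fun p : SubdivAlphabet ℓ => (μ.restrict {x | x 1 = p.1}).map fun x =>
    shift ((p.2 : ℕ) : ℤ) (wordMap (subdivision ℓ) (nonErasing_subdivision hℓ) x)

theorem measurable_level {ℓ : A → ℕ} (hℓ : ∀ a, 1 ≤ ℓ a) (k : ℕ) :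
    Measurable fun x : ℤ → A =>
      shift (k : ℤ) (wordMap (subdivision ℓ) (nonErasing_subdivision hℓ) x) :=
  (measurable_shift _).comp (measurable_wordMap (nonErasing_subdivision hℓ))

theorem towerMeasure_apply {ℓ : A → ℕ} (hℓ : ∀ a, 1 ≤ ℓ a) (μ : Measure (ℤ → A))
    {S : Set (ℤ → SubdivAlphabet ℓ)} (hS : MeasurableSet S) :
    towerMeasure ℓ hℓ μ S = ∑' p : SubdivAlphabet ℓ, μ {x | x 1 = p.1 ∧
      shift ((p.2 : ℕ) : ℤ) (wordMap (subdivision ℓ) (nonErasing_subdivision hℓ) x) ∈ S} := by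
  rw [towerMeasure, Measure.sum_apply _ hS]
  congr 1
  funext p
  rw [Measure.map_apply (measurable_level hℓ _) hS,
    Measure.restrict_apply (measurable_level hℓ _ hS), Set.inter_comm]
  rfl

theorem isFiniteMeasure_tower {ℓ : A → ℕ} (hℓ : ∀ a, 1 ≤ ℓ a) (μ : Measure (ℤ → A))
    [IsFiniteMeasure μ] : IsFiniteMeasure (towerMeasure ℓ hℓ μ) := by
  cases nonempty_fintype A
  refine ⟨?_⟩
  rw [towerMeasure_apply hℓ μ MeasurableSet.univ, tsum_fintype]
  exact ENNReal.sum_lt_top.2 fun p _ => measure_lt_top μ _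

theorem sum_letters [Fintype A] (μ : Measure (ℤ → A)) {P : (ℤ → A) → Prop}
    (hP : MeasurableSet {x | P x}) : ∑ a, μ {x | x 1 = a ∧ P x} = μ {x | P x} := by
  have hm : ∀ a : A, MeasurableSet {x : ℤ → A | x 1 = a} := fun a =>
    (measurable_pi_apply (1 : ℤ) : Measurable fun x : ℤ → A => x 1) (MeasurableSet.singleton a)
  rw [← measure_biUnion_finset]
  · congr 1
    ext x; simp
  · intro a _ b _ hab
    refine Set.disjoint_left.2 ?_
    rintro x ⟨h1, _⟩ ⟨h2, _⟩
    exact hab (h1.symm.trans h2)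
  · intro a _
    exact (hm a).inter hP

theorem measurePreserving_tower {ℓ : A → ℕ} (hℓ : ∀ a, 1 ≤ ℓ a) (μ : Measure (ℤ → A))
    [IsFiniteMeasure μ] (hμ : MeasurePreserving (shift (1 : ℤ)) μ μ) :
    MeasurePreserving (shift (1 : ℤ)) (towerMeasure ℓ hℓ μ) (towerMeasure ℓ hℓ μ) := by
  cases nonempty_fintype A
  refine ⟨measurable_shift _, ?_⟩
  ext S hS
  have hne := nonErasing_subdivision hℓ
  let u : A → ℕ → ℝ≥0∞ := fun a k => μ {x | x 1 = a ∧
    shift (k : ℤ) (wordMap (subdivision ℓ) (nonErasing_subdivision hℓ) x) ∈ S}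
  have e1 : towerMeasure ℓ hℓ μ S = ∑ a, ∑ k ∈ Finset.range (ℓ a), u a k := by
    rw [towerMeasure_apply hℓ μ hS, tsum_fintype, Fintype.sum_sigma]
    exact Finset.sum_congr rfl fun a _ => (Fin.sum_univ_eq_sum_range (u a) (ℓ a))
  have e2 : (towerMeasure ℓ hℓ μ).map (shift (1 : ℤ)) S
      = ∑ a, ∑ k ∈ Finset.range (ℓ a), u a (k + 1) := by
    rw [Measure.map_apply (measurable_shift _) hS,
      towerMeasure_apply hℓ μ (measurable_shift _ hS), tsum_fintype, Fintype.sum_sigma]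
    refine Finset.sum_congr rfl fun a _ => ?_
    rw [← Fin.sum_univ_eq_sum_range (fun k => u a (k + 1)) (ℓ a)]
    refine Finset.sum_congr rfl fun k _ => ?_
    simp only [u, Set.mem_preimage, ← shift_add]
    push_cast
    rfl
  have h0 : ∑ a, u a 0 = μ (wordMap (subdivision ℓ) hne ⁻¹' S) := by
    simp only [u, Nat.cast_zero, shift_zero]
    exact sum_letters μ (measurable_wordMap hne hS)
  have hl : ∑ a, u a (ℓ a) = μ (wordMap (subdivision ℓ) hne ⁻¹' S) := by
    have hm : MeasurableSet {x : ℤ → A | wordMap (subdivision ℓ) hne (shift (1 : ℤ) x) ∈ S} :=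
      ((measurable_wordMap hne).comp (measurable_shift 1)) hS
    rw [← hμ.measure_preimage (measurable_wordMap hne hS).nullMeasurableSet]
    refine Eq.trans ?_ (sum_letters μ hm)
    refine Finset.sum_congr rfl fun a _ => ?_
    simp only [u]
    congr 1
    ext x
    simp only [Set.mem_ofPred_eq]
    refine and_congr_right fun hx => ?_
    have h4 := wordMap_shift hne 1 x
    rw [blockStart_succ, blockStart_one, length_img_subdivision, hx, add_sub_cancel_left] at h4
    rw [← h4]
    rfl
  rw [e1, e2]
  have h3 : ∑ a, ∑ k ∈ Finset.range (ℓ a), u a (k + 1) + ∑ a, u a 0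
      = ∑ a, ∑ k ∈ Finset.range (ℓ a), u a k + ∑ a, u a (ℓ a) := by
    rw [← Finset.sum_add_distrib, ← Finset.sum_add_distrib]
    refine Finset.sum_congr rfl fun a _ => ?_
    rw [← Finset.sum_range_succ', ← Finset.sum_range_succ]
  rw [h0, hl] at h3
  exact (ENNReal.add_left_inj (measure_ne_top μ _)).1 h3

theorem towerMeasure_cylinder {ℓ : A → ℕ} (hℓ : ∀ a, 1 ≤ ℓ a) (μ : Measure (ℤ → A))
    {w : FreeMonoid (SubdivAlphabet ℓ)} (hw : w ≠ 1) :
    towerMeasure ℓ hℓ μ (cylinder w) = subdivWeight ℓ μ w := by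
  have hw' : w.toList ≠ [] := fun h => hw (FreeMonoid.toList.injective h)
  rw [towerMeasure_apply hℓ μ (measurableSet_cylinder w)]
  by_cases h : ∃ v, IsShortestCover ℓ w v
  · obtain ⟨v, hv⟩ := h
    rw [subdivWeight_eq hℓ μ hw hv, ← cylinder_tower_of_cover hℓ hw' hv]
    refine tsum_eq_single (w.toList.head hw') fun p hp => ?_
    refine measure_mono_null (t := ∅) ?_ measure_empty
    rintro x ⟨hx1, hx2⟩
    apply hp
    have hw0 : 0 < w.toList.length := List.length_pos_iff.2 hw'
    have h1 := hx2 0 hw0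
    obtain ⟨a, k⟩ := p
    simp only at hx1
    subst hx1
    rw [List.head_eq_getElem, ← h1]
    refine (wordMap_subdivision hℓ x k k.2).symm.trans ?_
    rw [shift_apply]
    congr 1
    push_cast; ring
  · rw [subdivWeight, dif_neg h]
    refine ENNReal.tsum_eq_zero.2 fun p => measure_mono_null (t := ∅) ?_ measure_empty
    rintro x ⟨_, hx2⟩
    exact cylinder_tower_of_not_cover hℓ h x p.2 hx2

/-- The weights `μ [ŵ]` of the non-empty words `w` define a unique invariant measure. -/
theorem existsUnique_subdivMeasure (ℓ : A → ℕ) (hℓ : ∀ a, 1 ≤ ℓ a)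
    (μ : InvariantMeasure (fullShift A ℤ)) :
    ∃! ν : InvariantMeasure (fullShift (SubdivAlphabet ℓ) ℤ),
      ∀ w : FreeMonoid (SubdivAlphabet ℓ), w ≠ 1 → ν.1 (cylinder w) = subdivWeight ℓ μ.1 w := by
  have := μ.2.1
  refine ⟨⟨towerMeasure ℓ hℓ μ.1, isFiniteMeasure_tower hℓ μ.1,
    measurePreserving_tower hℓ μ.1 μ.2.2.1, Set.subset_univ _⟩,
    fun w hw => towerMeasure_cylinder hℓ μ.1 hw, ?_⟩
  intro ν hν
  have := ν.2.1
  have := isFiniteMeasure_tower hℓ μ.1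
  apply Subtype.ext
  exact ext_of_cylinder ν.2.2.1 (measurePreserving_tower hℓ μ.1 μ.2.2.1) fun w hw => by
    rw [hν w hw, towerMeasure_cylinder hℓ μ.1 hw]

/-- The subdivision measure: the invariant measure on the full shift over the subdivision alphabet
with value `μ [ŵ]` on the cylinder of every non-empty word `w`. -/
noncomputable def subdivMeasure (ℓ : A → ℕ) (hℓ : ∀ a, 1 ≤ ℓ a)
    (μ : InvariantMeasure (fullShift A ℤ)) : InvariantMeasure (fullShift (SubdivAlphabet ℓ) ℤ) :=
  (existsUnique_subdivMeasure ℓ hℓ μ).choose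

theorem subdivMeasure_cylinder (ℓ : A → ℕ) (hℓ : ∀ a, 1 ≤ ℓ a)
    (μ : InvariantMeasure (fullShift A ℤ)) {w : FreeMonoid (SubdivAlphabet ℓ)} (hw : w ≠ 1) :
    (subdivMeasure ℓ hℓ μ).1 (cylinder w) = subdivWeight ℓ μ.1 w :=
  (existsUnique_subdivMeasure ℓ hℓ μ).choose_spec.1 w hw

theorem subdivMeasure_eq_tower (ℓ : A → ℕ) (hℓ : ∀ a, 1 ≤ ℓ a)
    (μ : InvariantMeasure (fullShift A ℤ)) :
    (subdivMeasure ℓ hℓ μ).1 = towerMeasure ℓ hℓ μ.1 := by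
  have := μ.2.1
  have := (existsUnique_subdivMeasure ℓ hℓ μ).choose_spec.2
    ⟨towerMeasure ℓ hℓ μ.1, isFiniteMeasure_tower hℓ μ.1,
      measurePreserving_tower hℓ μ.1 μ.2.2.1, Set.subset_univ _⟩
    (fun w hw => towerMeasure_cylinder hℓ μ.1 hw)
  exact (congrArg Subtype.val this).symm

/-! ### The measure transfer -/

/-- The map of biinfinite words given by a map of alphabets. -/
def letterwise {A B : Type*} (f : A → B) (x : ℤ → A) : ℤ → B := fun j => f (x j)

theorem measurable_letterwise {A B : Type*} [MeasurableSpace A] [DiscreteMeasurableSpace A]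
    [MeasurableSpace B] (f : A → B) : Measurable (letterwise f) :=
  measurable_pi_lambda _ fun j => Measurable.of_discrete.comp (measurable_pi_apply j)

/-- The classical push-forward of invariant measures under a letter-to-letter morphism, given by
its map of alphabets. -/
noncomputable def pushLetters {A B : Type*} [TopologicalSpace A] [MeasurableSpace A]
    [DiscreteMeasurableSpace A] [TopologicalSpace B] [MeasurableSpace B] (f : A → B)
    (μ : InvariantMeasure (fullShift A ℤ)) : InvariantMeasure (fullShift B ℤ) :=
  ⟨μ.1.map (letterwise f), by
    have := μ.2.1
    have hf := measurable_letterwise f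
    refine ⟨inferInstance, ⟨measurable_shift 1, ?_⟩, Set.subset_univ _⟩
    rw [Measure.map_map (measurable_shift 1) hf]
    have : shift (1 : ℤ) ∘ letterwise f = letterwise f ∘ shift (1 : ℤ) := rfl
    rw [this, ← Measure.map_map hf (measurable_shift 1), μ.2.2.1.map_eq]⟩

/-- The measure transfer on the full shift: the subdivision measure of `μ` for the canonical
subdivision of `σ`, pushed forward by the letter-to-letter morphism of `σ`. -/
noncomputable def measureTransferFull (σ : FreeMonoid A →* FreeMonoid B) (hσ : NonErasing σ)
    (μ : InvariantMeasure (fullShift A ℤ)) : InvariantMeasure (fullShift B ℤ) :=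
  pushLetters (letterMap σ) (subdivMeasure (lengthFun σ) hσ.one_le_lengthFun μ)

/-- The image subshift: the intersection of all subshifts containing the images of the words
in `X`. -/
def imageSubshift {A B : Type*} [TopologicalSpace A] [TopologicalSpace B]
    (σ : FreeMonoid A →* FreeMonoid B) (hσ : NonErasing σ) (X : Subshift A ℤ) : Subshift B ℤ where
  carrier := ⋂ (Y : Subshift B ℤ) (_ : wordMap σ hσ '' X.carrier ⊆ Y.carrier), Y.carrier
  isClosed := isClosed_iInter fun Y => isClosed_iInter fun _ => Y.isClosed
  mapsTo := fun g x hx => by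
    simp only [Set.mem_iInter] at hx ⊢
    exact fun Y hY => Y.mapsTo g (hx Y hY)

theorem letterwise_wordMap {A B : Type*} (σ : FreeMonoid A →* FreeMonoid B) (hσ : NonErasing σ)
    (x : ℤ → A) :
    letterwise (letterMap σ) (wordMap (subdivision (lengthFun σ))
      (nonErasing_subdivision hσ.one_le_lengthFun) x) = wordMap σ hσ x := by
  have hlen : ∀ a, (img (subdivision (lengthFun σ)) a).length = (img σ a).length := fun a =>
    length_img_subdivision a
  have hs : ∀ n, blockStart (subdivision (lengthFun σ)) x n = blockStart σ x n := fun n => by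
    simp only [blockStart, hlen]
  funext j
  obtain ⟨n, h1, h2⟩ := exists_block hσ x j
  have hk : (j - blockStart σ x n).toNat < (img σ (x n)).length := by lia
  rw [wordMap_of_block hσ x n _ hk j (by lia), letterwise,
    wordMap_of_block _ x n _ (by rw [hlen]; exact hk) j (by rw [hs]; lia),
    getElem_img_subdivision]
  rfl

theorem measureTransferFull_support (σ : FreeMonoid A →* FreeMonoid B) (hσ : NonErasing σ)
    (X : Subshift A ℤ) (μ : InvariantMeasure X) :
    (measureTransferFull σ hσ μ.toFull).1.support ⊆ (imageSubshift σ hσ X).carrier := by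
  rw [← measure_compl_eq_zero_iff]
  have hY : MeasurableSet (imageSubshift σ hσ X).carrierᶜ :=
    (imageSubshift σ hσ X).isClosed.measurableSet.compl
  change ((subdivMeasure (lengthFun σ) hσ.one_le_lengthFun μ.toFull).1.map (letterwise (letterMap σ))) _ = 0
  rw [Measure.map_apply (measurable_letterwise _) hY, subdivMeasure_eq_tower,
    towerMeasure_apply _ _ (measurable_letterwise _ hY)]
  refine ENNReal.tsum_eq_zero.2 fun p => measure_mono_null ?_
    ((measure_compl_eq_zero_iff μ.1 X).2 μ.2.2.2)
  rintro x ⟨_, hx⟩ hxX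
  apply hx
  change shift _ (letterwise (letterMap σ) (wordMap (subdivision (lengthFun σ)) _ x)) ∈ _
  rw [letterwise_wordMap σ hσ]
  refine (imageSubshift σ hσ X).mapsTo _ ?_
  exact Set.mem_iInter₂.2 fun Y hY => hY ⟨x, hxX, rfl⟩

/-- The measure transfer map from the invariant measures on `X` to those on the image subshift. -/
noncomputable def measureTransfer (σ : FreeMonoid A →* FreeMonoid B) (hσ : NonErasing σ)
    (X : Subshift A ℤ) (μ : InvariantMeasure X) : InvariantMeasure (imageSubshift σ hσ X) :=
  ⟨(measureTransferFull σ hσ μ.toFull).1, (measureTransferFull σ hσ μ.toFull).2.1,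
    (measureTransferFull σ hσ μ.toFull).2.2.1, measureTransferFull_support σ hσ X μ⟩

end Transfer

end MeasureTransfer

namespace MeasureTransfer

open MeasureTheory SymbolicDynamics.FullShift
open scoped ENNReal

/-! ### Shift-invariant Hahn decomposition. -/

section InvariantHahn

variable {A : Type*} [MeasurableSpace A]

/-! Write `a(k)` for the letters of the subdivision alphabet. The transferred measure of `μ` gives a
Borel set `S` the mass `∑ μ {x ∈ [a] : T^k σ(x) ∈ S}`, summed over all `a(k)` with `0 ≤ k < |σ(a)|`.
The sum is easy to read when membership of `T^k σ(x)` in `S` depends neither on `k` nor on anything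
about `x` except whether `x` lies in a set `E`: it is then `∑_a |σ(a)| μ([a] ∩ E)`. So the question
is which `E` can be detected from the image side, and whether these weighted sums suffice to compare
two measures.

Every shift-invariant Borel set `E` can be detected. Orbit injectivity says that points of `X` in
different orbits have images in different orbits, so the shift-saturated images of `X ∩ E` and of `X
\ E` are disjoint. They are images of Borel sets under Borel maps, hence analytic, and Lusin's
separation theorem gives a Borel set `S` containing the first and missing the second
(`ShiftOrbitInjective.exists_separating`).

For the comparison, let `μ` and `ν` have the same transfer, and choose `E` as a Hahn set of `μ - ν`,
so that `ν ≤ μ` inside `E`. Both measures are invariant, so `E` can be taken invariant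
(`exists_invariant_hahn`). Every term of the weighted sum for `ν` is at most the corresponding term
for `μ`, the sums are finite and equal, and every weight `|σ(a)|` is at least `1`. Hence `μ` and `ν`
agree on each `[a] ∩ E`, so on `E` itself, and by domination on every measurable subset of `E`
(`eq_on_of_le_of_measureTransfer_eq`). The complement of `E` is handled in the same way with the
measures exchanged. -/

/-- A Hahn decomposition of the difference of two finite shift-invariant measures can be chosen
shift-invariant. -/
theorem exists_invariant_hahn (μ ν : Measure (ℤ → A)) [IsFiniteMeasure μ] [IsFiniteMeasure ν]
    (hμ : MeasurePreserving (shift (1 : ℤ)) μ μ) (hν : MeasurePreserving (shift (1 : ℤ)) ν ν) :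
    ∃ E : Set (ℤ → A), MeasurableSet E ∧ (∀ n : ℤ, ∀ x, shift n x ∈ E ↔ x ∈ E) ∧
      (∀ F, MeasurableSet F → F ⊆ E → ν F ≤ μ F) ∧
      (∀ F, MeasurableSet F → F ⊆ Eᶜ → μ F ≤ ν F) := by
  obtain ⟨E₀, hE₀, hpos, hneg⟩ := hahn_decomposition μ ν
  have hm : ∀ n : ℤ, MeasurableSet (shift n ⁻¹' E₀) := fun n => measurable_shift n hE₀
  -- The union of all translates of a Hahn set is invariant. Its complement lies in the complement
  -- of `E₀`, so only the inequality inside the union needs work.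
  refine ⟨⋃ n : ℤ, shift n ⁻¹' E₀, MeasurableSet.iUnion hm, fun m x => ?_, fun F hF hFE => ?_,
    fun F hF hFE => hneg F hF (hFE.trans (Set.compl_subset_compl.2 fun x hx => ?_))⟩
  · simp only [Set.mem_iUnion, Set.mem_preimage, ← shift_add]
    exact ⟨fun ⟨n, h⟩ => ⟨_, h⟩, fun ⟨n, h⟩ => ⟨n - m, by simpa using h⟩⟩
  · have hpiece : ∀ (n : ℤ) (G : Set (ℤ → A)), MeasurableSet G → G ⊆ shift n ⁻¹' E₀ →
        ν G ≤ μ G := by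
      intro n G hG hGE
      have hm' := measurable_shift (A := A) (-n) hG
      have h := hpos (shift (-n) ⁻¹' G) hm' fun x hx => by
        simpa [← shift_add] using hGE hx
      rwa [(measurePreserving_shift hν (-n)).measure_preimage hG.nullMeasurableSet,
        (measurePreserving_shift hμ (-n)).measure_preimage hG.nullMeasurableSet] at h
    -- The translates overlap. Enumerating them by `ℕ` and disjointifying cuts `F` into countably
    -- many disjoint pieces, each inside one translate, so the inequalities can be summed.
    obtain ⟨e⟩ : Nonempty (ℕ ≃ ℤ) := ⟨(Denumerable.eqv ℤ).symm⟩
    let D : ℕ → Set (ℤ → A) := disjointed fun k => shift (e k) ⁻¹' E₀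
    have hD : ∀ k, MeasurableSet (F ∩ D k) := fun k =>
      hF.inter (MeasurableSet.disjointed (fun k => hm (e k)) k)
    have hdisj : Pairwise (Function.onFun Disjoint fun k => F ∩ D k) := fun i j hij =>
      (disjoint_disjointed _ hij).mono Set.inter_subset_right Set.inter_subset_right
    have hF' : F = ⋃ k, F ∩ D k := by
      rw [← Set.inter_iUnion, iUnion_disjointed, eq_comm, Set.inter_eq_left]
      exact hFE.trans (Set.iUnion_subset fun n => Set.subset_iUnion_of_subset (e.symm n) (by simp))
    rw [hF', measure_iUnion hdisj hD, measure_iUnion hdisj hD]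
    exact ENNReal.tsum_le_tsum fun k => hpiece (e k) _ (hD k)
      (Set.inter_subset_right.trans (disjointed_subset _ k))
  · exact Set.mem_iUnion.2 ⟨0, by simpa using hx⟩

end InvariantHahn

/-! ### Separating images of invariant sets and comparing transferred measures. -/

section Injectivity

variable {A B : Type*}

/-- Shifting the images does not change their orbits, so a coincidence of shifted images is an
equality of values of `orbitMap`. This is the pointwise form in which orbit injectivity is used. -/
theorem ShiftOrbitInjective.exists_shift_eq {σ : FreeMonoid A →* FreeMonoid B}
    {hσ : NonErasing σ} {X : Set (ℤ → A)} (hinj : ShiftOrbitInjective σ hσ X)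
    {x y : ℤ → A} (hx : x ∈ X) (hy : y ∈ X) {m n : ℤ}
    (h : shift m (wordMap σ hσ x) = shift n (wordMap σ hσ y)) : ∃ k : ℤ, shift k x = y := by
  have h1 : orbitMap σ hσ (shiftOrbit x) = orbitMap σ hσ (shiftOrbit y) :=
    Quotient.sound (show ∃ k : ℤ, shift k (wordMap σ hσ x) = wordMap σ hσ y from
      ⟨m + -n, by rw [shift_add, h, ← shift_add]; simp⟩)
  exact Quotient.exact (hinj ⟨x, hx, rfl⟩ ⟨y, hy, rfl⟩ h1)

variable [Finite A] [TopologicalSpace A] [DiscreteTopology A] [MeasurableSpace A]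
  [DiscreteMeasurableSpace A] [Finite B] [TopologicalSpace B] [DiscreteTopology B]
  [MeasurableSpace B] [DiscreteMeasurableSpace B]

/-- Each set in this countable union is the image of a Borel set under a Borel map. No injectivity
is assumed on `F`; analyticity is all that Lusin separation requires. -/
theorem analyticSet_saturated_image (σ : FreeMonoid A →* FreeMonoid B) (hσ : NonErasing σ)
    {F : Set (ℤ → A)} (hF : MeasurableSet F) :
    AnalyticSet (⋃ n : ℤ, (fun x => shift n (wordMap σ hσ x)) '' F) :=
  AnalyticSet.iUnion fun n =>
    hF.analyticSet_image ((measurable_shift n).comp (measurable_wordMap hσ))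

/-- If `σ` is shift-orbit injective in `X`, then the images of the two parts of `X` cut out by a
shift-invariant measurable set are separated by a measurable set. -/
theorem ShiftOrbitInjective.exists_separating {σ : FreeMonoid A →* FreeMonoid B}
    {hσ : NonErasing σ} {X : Set (ℤ → A)} (hinj : ShiftOrbitInjective σ hσ X)
    (hX : MeasurableSet X) {E : Set (ℤ → A)} (hE : MeasurableSet E)
    (hEinv : ∀ n : ℤ, ∀ x, shift n x ∈ E ↔ x ∈ E) :
    ∃ S : Set (ℤ → B), MeasurableSet S ∧
      ∀ x ∈ X, ∀ n : ℤ, shift n (wordMap σ hσ x) ∈ S ↔ x ∈ E := by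
  -- Lusin separation of the saturated images of `X ∩ E` and `X \ E`. A common point would put some
  -- `x ∈ E` and `y ∉ E` in the same orbit, against the invariance of `E`.
  obtain ⟨S, h1, h2, hS⟩ := (analyticSet_saturated_image σ hσ (hX.inter hE)).measurablySeparable
    (analyticSet_saturated_image σ hσ (hX.inter hE.compl)) (by
      refine Set.disjoint_left.2 ?_
      simp only [Set.mem_iUnion]
      rintro _ ⟨m, x, hx, rfl⟩ ⟨n, y, hy, h⟩
      obtain ⟨k, rfl⟩ := hinj.exists_shift_eq hx.1 hy.1 h.symm
      exact hy.2 ((hEinv k x).2 hx.2))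
  refine ⟨S, hS, fun x hx n => ⟨fun h => ?_, fun h => ?_⟩⟩
  · by_contra hxE
    exact Set.disjoint_left.1 h2 (Set.mem_iUnion.2 ⟨n, x, ⟨hx, hxE⟩, rfl⟩) h
  · exact h1 (Set.mem_iUnion.2 ⟨n, x, ⟨hx, h⟩, rfl⟩)

/-- The subdivision measure is the explicit tower measure, and subdividing a word and then applying
the letter map is `wordMap σ`. The positions `p.2` count from `0`, so `p.2 = 0` is the unshifted
image. -/
theorem measureTransfer_apply (σ : FreeMonoid A →* FreeMonoid B) (hσ : NonErasing σ)
    (X : Subshift A ℤ) (μ : InvariantMeasure X) {S : Set (ℤ → B)} (hS : MeasurableSet S) :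
    (measureTransfer σ hσ X μ).1 S = ∑' p : SubdivAlphabet (lengthFun σ),
      μ.1 {x | x 1 = p.1 ∧ shift ((p.2 : ℕ) : ℤ) (wordMap σ hσ x) ∈ S} := by
  change ((subdivMeasure (lengthFun σ) hσ.one_le_lengthFun μ.toFull).1.map
    (letterwise (letterMap σ))) S = _
  rw [Measure.map_apply (measurable_letterwise _) hS, subdivMeasure_eq_tower,
    towerMeasure_apply _ _ (measurable_letterwise _ hS)]
  simp only [← letterwise_wordMap σ hσ]
  rfl

/-- On a separating set, the transferred measure is the measure weighted by block lengths. -/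
theorem measureTransfer_apply_of_separating (σ : FreeMonoid A →* FreeMonoid B)
    (hσ : NonErasing σ) (X : Subshift A ℤ) (μ : InvariantMeasure X) {S : Set (ℤ → B)}
    (hS : MeasurableSet S) {E : Set (ℤ → A)}
    (hSE : ∀ x ∈ X.carrier, ∀ n : ℤ, shift n (wordMap σ hσ x) ∈ S ↔ x ∈ E) :
    (measureTransfer σ hσ X μ).1 S =
      ∑' p : SubdivAlphabet (lengthFun σ), μ.1 ({x | x 1 = p.1} ∩ E) := by
  rw [measureTransfer_apply σ hσ X μ hS]
  congr 1
  funext p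
  refine measure_congr ?_
  -- The two sets need only agree on `X`, which carries all the mass of `μ`. The summand on the
  -- right no longer depends on `p.2`; this is where the weights `|σ(a)|` come from.
  have hX : ∀ᵐ x ∂μ.1, x ∈ X.carrier :=
    mem_ae_iff.2 ((measure_compl_eq_zero_iff μ.1 X).2 μ.2.2.2)
  filter_upwards [hX] with x hx
  exact propext (and_congr_right fun _ => hSE x hx _)

/-- Two invariant measures with the same transfer, one dominating the other on a shift-invariant
set, agree on the subsets of it. -/
theorem eq_on_of_le_of_measureTransfer_eq {σ : FreeMonoid A →* FreeMonoid B}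
    {hσ : NonErasing σ} {X : Subshift A ℤ} (hinj : ShiftOrbitInjective σ hσ X.carrier)
    {μ ν : InvariantMeasure X} (h : measureTransfer σ hσ X μ = measureTransfer σ hσ X ν)
    {E : Set (ℤ → A)} (hE : MeasurableSet E) (hEinv : ∀ n : ℤ, ∀ x, shift n x ∈ E ↔ x ∈ E)
    (hle : ∀ F, MeasurableSet F → F ⊆ E → ν.1 F ≤ μ.1 F)
    {F : Set (ℤ → A)} (hF : MeasurableSet F) (hFE : F ⊆ E) : μ.1 F = ν.1 F := by
  cases nonempty_fintype A
  have := μ.2.1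
  have := ν.2.1
  classical
  obtain ⟨S, hS, hSE⟩ := hinj.exists_separating X.isClosed.measurableSet hE hEinv
  have hm : ∀ a : A, MeasurableSet ({x : ℤ → A | x 1 = a} ∩ E) := fun a =>
    ((measurable_pi_apply (1 : ℤ) : Measurable fun x : ℤ → A => x 1)
      (MeasurableSet.singleton a)).inter hE
  have hsum := congrArg (fun ρ => ρ.1 S) h
  simp only [measureTransfer_apply_of_separating σ hσ X _ hS hSE, tsum_fintype] at hsum
  -- A strict inequality at one letter would make the whole sum strictly larger, since all other
  -- terms are ordered the same way and are finite.
  have hletter : ∀ a : A, μ.1 ({x | x 1 = a} ∩ E) = ν.1 ({x | x 1 = a} ∩ E) := by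
    intro a
    by_contra hne
    have hlt := lt_of_le_of_ne (hle _ (hm a) Set.inter_subset_right) (Ne.symm hne)
    -- One occurrence of the term for `a` suffices. Position `0` exists because `σ` is non-erasing.
    let p : SubdivAlphabet (lengthFun σ) := ⟨a, ⟨0, hσ.one_le_lengthFun a⟩⟩
    rw [← Finset.add_sum_erase _ _ (Finset.mem_univ p),
      ← Finset.add_sum_erase _ _ (Finset.mem_univ p)] at hsum
    refine (ENNReal.add_lt_add_of_lt_of_le ?_ hlt ?_).ne hsum.symm
    · exact (ENNReal.sum_lt_top.2 fun q _ => measure_lt_top _ _).ne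
    · exact Finset.sum_le_sum fun q _ => hle _ (hm q.1) Set.inter_subset_right
  have htot : μ.1 E = ν.1 E := by
    have e : ∀ ρ : Measure (ℤ → A), ρ E = ∑ a, ρ ({x | x 1 = a} ∩ E) := fun ρ =>
      (sum_letters ρ (P := fun x => x ∈ E) hE).symm
    rw [e, e]
    exact Finset.sum_congr rfl fun a _ => hletter a
  refine le_antisymm ?_ (hle F hF hFE)
  -- With equal finite totals on `E`, an excess of `μ` over `ν` on `F` would need a deficit on `E \
  -- F`, which domination excludes.
  have hdiff := hle (E \ F) (hE.diff hF) Set.sdiff_subset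
  rw [← measure_inter_add_sdiff E hF, ← measure_inter_add_sdiff E hF,
    Set.inter_eq_self_of_subset_right hFE] at htot
  by_contra! hlt
  exact (ENNReal.add_lt_add_of_lt_of_le (measure_ne_top _ _) hlt hdiff).ne htot.symm

end Injectivity

end MeasureTransfer

theorem mainTheorem1 {A B : Type*}
    [Finite A] [TopologicalSpace A] [DiscreteTopology A]
    [MeasurableSpace A] [DiscreteMeasurableSpace A]
    [Finite B] [TopologicalSpace B] [DiscreteTopology B]
    [MeasurableSpace B] [DiscreteMeasurableSpace B]
    (σ : FreeMonoid A →* FreeMonoid B) (hσ : MeasureTransfer.NonErasing σ)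
    (X : SymbolicDynamics.FullShift.Subshift A ℤ) (hX : X.carrier.Nonempty)
    (hinj : MeasureTransfer.ShiftOrbitInjective σ hσ X.carrier) :
    Function.Injective (MeasureTransfer.measureTransfer σ hσ X) := by
  intro μ ν h
  have := μ.2.1
  have := ν.2.1
  obtain ⟨E, hE, hEinv, hpos, hneg⟩ :=
    MeasureTransfer.exists_invariant_hahn μ.1 ν.1 μ.2.2.1 ν.2.2.1
  apply Subtype.ext
  ext F hF
  rw [← MeasureTheory.measure_inter_add_sdiff F hE, ← MeasureTheory.measure_inter_add_sdiff F hE]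
  congr 1
  · exact MeasureTransfer.eq_on_of_le_of_measureTransfer_eq hinj h hE hEinv hpos
      (hF.inter hE) Set.inter_subset_right
  -- Off `E` it is `ν` that dominates, so the roles of `μ` and `ν` are exchanged; the complement of
  -- an invariant set is invariant.
  · exact (MeasureTransfer.eq_on_of_le_of_measureTransfer_eq hinj h.symm hE.compl
      (fun n x => not_congr (hEinv n x)) hneg (hF.diff hE) fun x hx => hx.2).symm
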